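/- Let $F$ be a field, $X$ a finite set, $F\langle X\rangle$ the free associative algebra on $X$ graded by word length, and $I$ a homogeneous two-sided ideal. Let $A=F\langle X\rangle/I=\bigoplus_{n\ge 0}A_n$ with the induced grading, $a_n=\dim_F A_n$, and let $H(A)=\limsup_{n\to\infty}\sqrt[n]{a_n}$ be the entropy of $A$. (a) Suppose that $\dim A_2=k=m^2+\ell$ with integers $m,\ell$ such that $1\le\ell\le 2m$. Then $$H(A)\le\frac{m+\sqrt{m^2+2\ell}}{2}<\sqrt{k}.$$ If $\ell=1$, then $H(A)\le m$. If $\ell=2m-3$, then $$H(A)\le\frac{m-1+\sqrt{m^2+6m-7}}{2}.$$ (b) For every integer $\ell\ge 0$ there is an $M(\ell)$, depending only on $\ell$, such that for every integer $m\ge M(\ell)$, with $p=\lfloor\ell/2\rfloor$ and $q=\lceil\ell/2\rceil$, the polynomial $t^3-mt^2-pt+mp-pq$ has a positive real root, and its largest positive root $\rho_{m,p,q}$ satisfies: for every field $F$, every finite set $X$ and every homogeneous two-sided ideal $I$ as above, $$\dim A_2=m^2+\ell\quad\Longrightarrow\quad H(A)\le\rho_{m,\lfloor\ell/2\rfloor,\lceil\ell/2\rceil}.$$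 -/

import Mathlib

namespace EntropyBounds

/-- The span of the letters in the free associative algebra `F⟨X⟩`. -/
def letters (F X : Type*) [Field F] : Submodule F (FreeAlgebra F X) :=
  Submodule.span F (Set.range (FreeAlgebra.ι F))

/-- The degree `n` part of `F⟨X⟩`: the `n`-th power of the span of the letters, that is, the
span of the words of length `n` (see `degreePart_eq_span_words`). -/
def degreePart (F X : Type*) [Field F] (n : ℕ) : Submodule F (FreeAlgebra F X) :=
  letters F X ^ n

open Pointwise in
/-- `degreePart F X n` is the span of the words of length `n`. -/
theorem degreePart_eq_span_words (F X : Type*) [Field F] (n : ℕ) :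
    degreePart F X n = Submodule.span F
      {w : FreeAlgebra F X | ∃ l : List X, l.length = n ∧ w = (l.map (FreeAlgebra.ι F)).prod} := by
  rw [degreePart, letters, Submodule.span_pow]
  congr 1
  induction n with
  | zero => ext w; simp [List.length_eq_zero_iff]
  | succ n ih =>
    rw [pow_succ', ih]
    ext w
    simp only [Set.mem_mul, Set.mem_range, Set.mem_ofPred_eq]
    constructor
    · rintro ⟨_, ⟨x, rfl⟩, _, ⟨l, hl, rfl⟩, rfl⟩
      exact ⟨x :: l, by simp [hl], by simp⟩
    · rintro ⟨l, hl, rfl⟩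
      cases l with
      | nil => simp at hl
      | cons x l => exact ⟨_, ⟨x, rfl⟩, _, ⟨l, by simpa using hl, rfl⟩, by simp⟩

theorem ι_mem_degreePart_one (F : Type*) {X : Type*} [Field F] (x : X) :
    FreeAlgebra.ι F x ∈ degreePart F X 1 := by
  rw [degreePart, pow_one]
  exact Submodule.subset_span ⟨x, rfl⟩

instance degreePart_gradedMonoid (F X : Type*) [Field F] :
    SetLike.GradedMonoid (degreePart F X) :=
  inferInstanceAs (SetLike.GradedMonoid (fun n : ℕ => letters F X ^ n))

open DirectSum in
/-- The grading of `F⟨X⟩` by word length. -/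
noncomputable instance freeAlgebraGraded (F X : Type*) [Field F] :
    GradedAlgebra (degreePart F X) :=
  GradedAlgebra.ofAlgHom _
    (FreeAlgebra.lift F fun x =>
      DirectSum.of (fun n : ℕ => degreePart F X n) 1 ⟨FreeAlgebra.ι F x, ι_mem_degreePart_one F x⟩)
    (by
      ext x
      simp [DirectSum.coeAlgHom_of])
    fun i x => by
      obtain ⟨x, hx⟩ := x
      dsimp only
      induction hx using Submodule.pow_induction_on_left' with
      | algebraMap r =>
        rw [AlgHom.commutes, DirectSum.algebraMap_apply]; rfl
      | add x y i hx hy ihx ihy =>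
        rw [map_add, ihx, ihy, ← map_add]
        rfl
      | mem_mul m hm i x hx ih =>
        rw [map_mul, ih]
        have key : ∀ m (hm : m ∈ letters F X),
            (FreeAlgebra.lift F fun x => DirectSum.of (fun n : ℕ => degreePart F X n) 1
              ⟨FreeAlgebra.ι F x, ι_mem_degreePart_one F x⟩) m
            = DirectSum.of (fun n : ℕ => degreePart F X n) 1
              ⟨m, by rw [degreePart, pow_one]; exact hm⟩ := by
          intro m hm
          induction hm using Submodule.span_induction with
          | mem y hy => obtain ⟨y, rfl⟩ := hy; simp
          | zero => rw [map_zero]; exact (map_zero _).symm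
          | add a b _ _ iha ihb => rw [map_add, iha, ihb, ← map_add]; rfl
          | smul c a _ iha =>
            rw [map_smul, iha]
            exact (DirectSum.lof F ℕ (fun n : ℕ => degreePart F X n) 1).map_smul c _ |>.symm
        rw [key m hm, DirectSum.of_mul_of]
        exact DirectSum.of_eq_of_gradedMonoid_eq (Sigma.subtype_ext (add_comm _ _) rfl)

/-- The degree `n` part `A_n` of the quotient `A = F⟨X⟩ / I`: the image of the degree `n` part of
the free algebra. -/
def quotientPart {F X : Type*} [Field F] (I : Ideal (FreeAlgebra F X)) [I.IsTwoSided] (n : ℕ) :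
    Submodule F (FreeAlgebra F X ⧸ I) :=
  (degreePart F X n).map (Ideal.Quotient.mkₐ F I).toLinearMap

/-- `a_n = dim A_n`. -/
noncomputable def hilbertFn {F X : Type*} [Field F] (I : Ideal (FreeAlgebra F X)) [I.IsTwoSided]
    (n : ℕ) : ℕ :=
  Module.finrank F (quotientPart I n)

/-- The entropy `H(A) = limsup a_n ^ (1 / n)` of `A = F⟨X⟩ / I`. For finite `X` the sequence lies
in the interval `[0, max 1 |X|]`, so the real limsup is the true one. -/
noncomputable def entropy {F X : Type*} [Field F] (I : Ideal (FreeAlgebra F X)) [I.IsTwoSided] :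
    ℝ :=
  Filter.limsup (fun n : ℕ => (hilbertFn I n : ℝ) ^ (1 / (n : ℝ))) Filter.atTop

/-- `ρ` is the largest positive real root of `t³ - m t² - p t + m p - p q`. -/
def IsLargestPositiveRoot (m p q : ℕ) (ρ : ℝ) : Prop :=
  IsGreatest {t : ℝ | 0 < t ∧ t ^ 3 - m * t ^ 2 - p * t + m * p - p * q = 0} ρ

end EntropyBounds

universe u v

/-! Order the letters. A word containing a two-letter subword that is not normal is, modulo `I`, a
combination of lexicographically smaller words. Hence `A_n` is spanned by walks with `n` vertices in
a digraph having exactly `dim A_2` edges (`sum_card_normalNbr`, `hilbertFn_succ_le`). Sorting the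
vertices by out-degree and pushing neighbourhoods to initial segments does not lower the walk
counts, so the digraph may be replaced by a Young diagram with `dim A_2` cells
(`exists_youngDiagram_walkCount`).

For a diagram with Durfee side `d`, let `N` be the size of the shorter leg and `P` the scalar
product of the legs. An explicit positive vector shows that walks grow at most like `t ^ n` once `N
< t²` and `P ≤ (t - d)(t² - N)` (`hasGrowth_of_legProduct_le`). What remains is to bound `P`: by `d
N`, by the product of the leg sizes, or by a convexity estimate. When `d = m` the second bound gives
the cubic of (b). When `d < m` and `m` is large, growth rate `m` already suffices
(`hasGrowth_of_durfee_lt`). -/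

namespace YoungDiagram

open Finset

/-! ### Walk counts and supersolutions. -/

/-- The number of sequences `i = i₀, i₁, …, iₙ` all of whose consecutive pairs are cells of `μ`. -/
def walkCount (μ : YoungDiagram) : ℕ → ℕ → ℕ
  | 0, _ => 1
  | n + 1, i => ∑ j ∈ range (μ.rowLen i), μ.walkCount n j

/-- The numbers of walks in `μ` grow at most like `t ^ n`. -/
def HasGrowth (μ : YoungDiagram) (t : ℝ) : Prop :=
  ∃ K : ℝ, ∀ n i, (μ.walkCount (n + 1) i : ℝ) ≤ K * t ^ n

/-- A common strict bound for the row and column indices of the cells of `μ`. -/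
def sideBound (μ : YoungDiagram) : ℕ := μ.rowLen 0 + μ.colLen 0

theorem lt_rowLen_iff_lt_colLen {μ : YoungDiagram} {i j : ℕ} :
    j < μ.rowLen i ↔ i < μ.colLen j := by
  rw [← mem_iff_lt_rowLen, mem_iff_lt_colLen]

theorem rowLen_le_sideBound (μ : YoungDiagram) (i : ℕ) : μ.rowLen i ≤ μ.sideBound :=
  (μ.rowLen_anti 0 i i.zero_le).trans (Nat.le_add_right _ _)

theorem colLen_le_sideBound (μ : YoungDiagram) (j : ℕ) : μ.colLen j ≤ μ.sideBound :=
  (μ.colLen_anti 0 j j.zero_le).trans (Nat.le_add_left _ _)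

theorem rowLen_eq_zero_of_sideBound_le {μ : YoungDiagram} {i : ℕ} (h : μ.sideBound ≤ i) :
    μ.rowLen i = 0 := by
  by_contra h0
  have := lt_rowLen_iff_lt_colLen.1 (Nat.pos_of_ne_zero h0)
  have := μ.colLen_le_sideBound 0
  omega

theorem sideBound_transpose (μ : YoungDiagram) : μ.transpose.sideBound = μ.sideBound := by
  simp [sideBound, add_comm]

/-- A nonnegative vector `x`, positive on the nonempty rows, with `A x ≤ t x` for the incidence
matrix `A` of `μ`. -/
structure IsSupersolution (μ : YoungDiagram) (t : ℝ) (x : ℕ → ℝ) : Prop where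
  nonneg : ∀ i, 0 ≤ x i
  pos : ∀ i, 0 < μ.rowLen i → 0 < x i
  le : ∀ i, ∑ j ∈ range (μ.rowLen i), x j ≤ t * x i

/-- The row lengths are the vector `A 1`, which is at most `K₀ x`; applying `A` repeatedly
multiplies the bound by `t`. -/
theorem IsSupersolution.hasGrowth {μ : YoungDiagram} {t : ℝ} {x : ℕ → ℝ} (ht : 0 < t)
    (hx : μ.IsSupersolution t x) : μ.HasGrowth t := by
  set N := μ.sideBound
  set K₀ : ℝ := ∑ i ∈ range N, μ.rowLen i / x i with hK₀
  have hK₀0 : 0 ≤ K₀ := sum_nonneg fun i _ => div_nonneg (Nat.cast_nonneg _) (hx.nonneg i)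
  have h1 : ∀ i, (μ.rowLen i : ℝ) ≤ K₀ * x i := fun i => by
    rcases Nat.eq_zero_or_pos (μ.rowLen i) with h | h
    · rw [h, Nat.cast_zero]; exact mul_nonneg hK₀0 (hx.nonneg i)
    · have hi : i < N := lt_of_not_ge fun h' => h.ne' (rowLen_eq_zero_of_sideBound_le h')
      rw [← div_le_iff₀ (hx.pos i h)]
      exact single_le_sum (f := fun i => (μ.rowLen i : ℝ) / x i)
        (fun i _ => div_nonneg (Nat.cast_nonneg _) (hx.nonneg i)) (mem_range.2 hi)
  have key : ∀ n i, (μ.walkCount (n + 1) i : ℝ) ≤ K₀ * t ^ n * x i := by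
    intro n
    induction n with
    | zero => intro i; simpa [walkCount] using h1 i
    | succ n ih =>
      intro i
      rw [walkCount, Nat.cast_sum]
      calc ∑ j ∈ range (μ.rowLen i), (μ.walkCount (n + 1) j : ℝ)
          ≤ ∑ j ∈ range (μ.rowLen i), K₀ * t ^ n * x j := sum_le_sum fun j _ => ih j
        _ = K₀ * t ^ n * ∑ j ∈ range (μ.rowLen i), x j := (mul_sum _ _ _).symm
        _ ≤ K₀ * t ^ n * (t * x i) := mul_le_mul_of_nonneg_left (hx.le i) (by positivity)
        _ = K₀ * t ^ (n + 1) * x i := by ring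
  refine ⟨K₀ * ∑ i ∈ range N, x i, fun n i => ?_⟩
  have hS : 0 ≤ ∑ i ∈ range N, x i := sum_nonneg fun i _ => hx.nonneg i
  rcases lt_or_ge i N with h | h
  · refine (key n i).trans ?_
    rw [mul_right_comm]
    gcongr
    exact single_le_sum (fun i _ => hx.nonneg i) (mem_range.2 h)
  · rw [walkCount, rowLen_eq_zero_of_sideBound_le h]
    simp only [range_zero, sum_empty, Nat.cast_zero]
    positivity

/-- Here `z` acts as a row vector with `z A ≤ t z`, so the weighted total `Q n = z Aⁿ 1` gains at
most a factor `t` per step. Every column met by a row has positive weight, so `Q n` controls each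
individual count. -/
theorem IsSupersolution.hasGrowth_of_transpose {μ : YoungDiagram} {t : ℝ} {z : ℕ → ℝ} (ht : 0 < t)
    (hz : μ.transpose.IsSupersolution t z) : μ.HasGrowth t := by
  set N := μ.sideBound
  have hle : ∀ j, ∑ i ∈ range (μ.colLen j), z i ≤ t * z j := fun j => by
    simpa using hz.le j
  set Q : ℕ → ℝ := fun n => ∑ j ∈ range N, z j * μ.walkCount n j with hQ
  have hstep : ∀ n, Q (n + 1) ≤ t * Q n := fun n => by
    calc Q (n + 1)
        = ∑ i ∈ range N, ∑ j ∈ range (μ.rowLen i), z i * μ.walkCount n j := by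
          simp only [hQ, walkCount, Nat.cast_sum, mul_sum]
      _ = ∑ j ∈ range N, ∑ i ∈ range (μ.colLen j), z i * μ.walkCount n j := by
          refine sum_comm' fun i j => ?_
          simp only [mem_range, lt_rowLen_iff_lt_colLen]
          refine ⟨fun h => ⟨h.2, ?_⟩, fun h => ⟨h.1.trans_le (μ.colLen_le_sideBound j), h.1⟩⟩
          exact (lt_rowLen_iff_lt_colLen.2 h.2).trans_le (μ.rowLen_le_sideBound i)
      _ ≤ ∑ j ∈ range N, t * z j * μ.walkCount n j := by
          refine sum_le_sum fun j _ => ?_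
          rw [← sum_mul]
          exact mul_le_mul_of_nonneg_right (hle j) (Nat.cast_nonneg _)
      _ = t * Q n := by simp only [hQ, mul_sum, mul_assoc]
  have hQn : ∀ n, Q n ≤ Q 0 * t ^ n := fun n => by
    induction n with
    | zero => simp
    | succ n ih =>
      refine (hstep n).trans ((mul_le_mul_of_nonneg_left ih ht.le).trans_eq ?_)
      ring
  have hz0 := hz.nonneg
  set K₀ : ℝ := ∑ j ∈ range N, (z j)⁻¹ with hK₀
  have hK₀0 : 0 ≤ K₀ := sum_nonneg fun i _ => inv_nonneg.2 (hz0 i)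
  have h1 : ∀ i, ∀ j < μ.rowLen i, 1 ≤ K₀ * z j := fun i j hj => by
    have hp : 0 < z j := hz.pos j <| by
      rw [rowLen_transpose]
      exact (Nat.zero_le i).trans_lt (lt_rowLen_iff_lt_colLen.1 hj)
    have := single_le_sum (f := fun j => (z j)⁻¹) (fun i _ => inv_nonneg.2 (hz0 i))
      (mem_range.2 (hj.trans_le (μ.rowLen_le_sideBound i)))
    calc (1 : ℝ) = (z j)⁻¹ * z j := (inv_mul_cancel₀ hp.ne').symm
      _ ≤ K₀ * z j := mul_le_mul_of_nonneg_right this hp.le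
  refine ⟨K₀ * Q 0, fun n i => ?_⟩
  calc (μ.walkCount (n + 1) i : ℝ) = ∑ j ∈ range (μ.rowLen i), (μ.walkCount n j : ℝ) := by
        simp [walkCount]
    _ ≤ ∑ j ∈ range (μ.rowLen i), K₀ * (z j * μ.walkCount n j) := by
        refine sum_le_sum fun j hj => ?_
        rw [← mul_assoc]
        exact le_mul_of_one_le_left (Nat.cast_nonneg _) (h1 i j (mem_range.1 hj))
    _ ≤ ∑ j ∈ range N, K₀ * (z j * μ.walkCount n j) :=
        sum_le_sum_of_subset_of_nonneg (range_subset_range.2 (μ.rowLen_le_sideBound i))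
          fun j _ _ => mul_nonneg hK₀0 (mul_nonneg (hz0 j) (Nat.cast_nonneg _))
    _ = K₀ * Q n := (mul_sum _ _ _).symm
    _ ≤ K₀ * (Q 0 * t ^ n) := mul_le_mul_of_nonneg_left (hQn n) hK₀0
    _ = K₀ * Q 0 * t ^ n := by ring

/-! ### The Durfee square and its legs. -/

theorem exists_diag_notMem (μ : YoungDiagram) : ∃ d, (d, d) ∉ μ := by
  refine ⟨μ.sideBound, fun h => ?_⟩
  have := mem_iff_lt_rowLen.1 h
  have := μ.rowLen_le_sideBound μ.sideBound
  omega

open Classical in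
/-- The side of the Durfee square of `μ`. -/
noncomputable def durfee (μ : YoungDiagram) : ℕ := Nat.find μ.exists_diag_notMem

theorem rowLen_le_durfee {μ : YoungDiagram} {i : ℕ} (h : μ.durfee ≤ i) :
    μ.rowLen i ≤ μ.durfee := by
  classical
  by_contra! h'
  exact Nat.find_spec μ.exists_diag_notMem (μ.up_left_mem h le_rfl (mem_iff_lt_rowLen.2 h'))

theorem colLen_le_durfee {μ : YoungDiagram} {j : ℕ} (h : μ.durfee ≤ j) :
    μ.colLen j ≤ μ.durfee := by
  classical
  by_contra! h'
  exact Nat.find_spec μ.exists_diag_notMem (μ.up_left_mem le_rfl h (mem_iff_lt_colLen.2 h'))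

theorem durfee_le_rowLen {μ : YoungDiagram} {i : ℕ} (h : i < μ.durfee) :
    μ.durfee ≤ μ.rowLen i := by
  classical
  by_contra! h'
  have hm : μ.durfee - 1 < Nat.find μ.exists_diag_notMem :=
    Nat.sub_lt ((Nat.zero_le i).trans_lt h) one_pos
  have := Nat.find_min μ.exists_diag_notMem hm
  rw [not_not] at this
  have h2 := mem_iff_lt_rowLen.1 (μ.up_left_mem (show i ≤ μ.durfee - 1 by omega)
    (show μ.durfee - 1 ≤ μ.durfee - 1 from le_rfl) this)
  omega

theorem durfee_transpose (μ : YoungDiagram) : μ.transpose.durfee = μ.durfee := by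
  simp [durfee, mem_transpose]

/-- The number of cells of `μ` below its Durfee square. -/
noncomputable def lowerLeg (μ : YoungDiagram) : ℕ :=
  ∑ j ∈ Ico μ.durfee μ.sideBound, μ.rowLen j

/-- The number of cells of `μ` to the right of its Durfee square. -/
noncomputable def rightLeg (μ : YoungDiagram) : ℕ :=
  ∑ j ∈ Ico μ.durfee μ.sideBound, μ.colLen j

/-- The scalar product of the row lengths below the Durfee square with the column lengths to the
right of it. -/
noncomputable def legProduct (μ : YoungDiagram) : ℕ :=
  ∑ j ∈ Ico μ.durfee μ.sideBound, μ.colLen j * μ.rowLen j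

theorem lowerLeg_transpose (μ : YoungDiagram) : μ.transpose.lowerLeg = μ.rightLeg := by
  simp [lowerLeg, rightLeg, durfee_transpose, sideBound_transpose]

theorem legProduct_transpose (μ : YoungDiagram) : μ.transpose.legProduct = μ.legProduct := by
  simp [legProduct, durfee_transpose, sideBound_transpose, mul_comm]

/-- Double counting of the cells right of the square. With `f = 1` it gives the size of the right
leg, with `f = μ.rowLen` the leg product. -/
theorem sum_rows_beyond_durfee (μ : YoungDiagram) (f : ℕ → ℕ) :
    ∑ i ∈ range μ.durfee, ∑ j ∈ Ico μ.durfee (μ.rowLen i), f j =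
      ∑ j ∈ Ico μ.durfee μ.sideBound, μ.colLen j * f j := by
  rw [sum_comm' (t' := Ico μ.durfee μ.sideBound) (s' := fun j => range (μ.colLen j))]
  · simp
  · intro i j
    simp only [mem_range, mem_Ico]
    constructor
    · rintro ⟨_, h2, h3⟩
      exact ⟨lt_rowLen_iff_lt_colLen.1 h3, h2, h3.trans_le (μ.rowLen_le_sideBound i)⟩
    · rintro ⟨h1, h2, _⟩
      exact ⟨h1.trans_le (colLen_le_durfee h2), h2, lt_rowLen_iff_lt_colLen.2 h1⟩

theorem card_eq_sum_rowLen (μ : YoungDiagram) {N : ℕ} (hN : ∀ i, N ≤ i → μ.rowLen i = 0) :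
    μ.card = ∑ i ∈ range N, μ.rowLen i := by
  rw [YoungDiagram.card, card_eq_sum_card_fiberwise (f := Prod.fst) (t := range N)]
  · exact sum_congr rfl fun i _ => μ.rowLen_eq_card.symm
  · rintro ⟨i, j⟩ h
    have h' : j < μ.rowLen i := mem_iff_lt_rowLen.1 h
    by_contra hi
    have := hN i (by simpa using hi)
    omega

theorem durfee_le_sideBound (μ : YoungDiagram) : μ.durfee ≤ μ.sideBound := by
  rcases Nat.eq_zero_or_pos μ.durfee with h | h
  · omega
  · exact (durfee_le_rowLen h).trans (μ.rowLen_le_sideBound 0)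

theorem card_eq_durfee_add_legs (μ : YoungDiagram) :
    μ.card = μ.durfee ^ 2 + μ.lowerLeg + μ.rightLeg := by
  rw [card_eq_sum_rowLen μ fun i => rowLen_eq_zero_of_sideBound_le, lowerLeg, rightLeg,
    ← sum_range_add_sum_Ico _ μ.durfee_le_sideBound]
  have h := μ.sum_rows_beyond_durfee fun _ => 1
  have h2 : ∑ i ∈ range μ.durfee, μ.rowLen i =
      ∑ i ∈ range μ.durfee, (μ.durfee + ∑ j ∈ Ico μ.durfee (μ.rowLen i), 1) := by
    refine sum_congr rfl fun i hi => ?_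
    have := durfee_le_rowLen (mem_range.1 hi)
    simp; omega
  rw [h2, sum_add_distrib, h]
  simp
  ring

/-! ### Growth from the leg data. -/

theorem exists_supersolution (μ : YoungDiagram) {t : ℝ} (ht : 0 < t)
    (hN : (μ.lowerLeg : ℝ) < t ^ 2)
    (hP : (μ.legProduct : ℝ) ≤ (t - μ.durfee) * (t ^ 2 - μ.lowerLeg)) :
    ∃ x, μ.IsSupersolution t x := by
  set d := μ.durfee with hd
  set N := μ.lowerLeg with hNdef
  set E : ℕ → ℕ := fun i => ∑ j ∈ Ico d (μ.rowLen i), μ.rowLen j with hE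
  have hEN : ∀ i, E i ≤ N := fun i =>
    sum_le_sum_of_subset (Ico_subset_Ico_right (μ.rowLen_le_sideBound i))
  have hEP : ∑ i ∈ range d, E i = μ.legProduct := μ.sum_rows_beyond_durfee _
  -- `E i` counts the two-step passages from row `i` through the right leg into the lower leg.
  -- Entries on the top `d` rows are at most `t²`, so `t * rowLen` works below the square; on the
  -- top rows the terms `t * E i` cancel and exactly `hP` remains.
  set x : ℕ → ℝ := fun i => if i < d then t ^ 2 - N + E i else t * μ.rowLen i with hx
  have hxlt : ∀ i, i < d → x i = t ^ 2 - N + E i := fun i h => if_pos h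
  have hxge : ∀ i, d ≤ i → x i = t * μ.rowLen i := fun i h => if_neg h.not_gt
  refine ⟨x, fun i => ?_, fun i hi => ?_, fun i => ?_⟩
  · rcases lt_or_ge i d with h | h
    · rw [hxlt i h]; have : (0 : ℝ) ≤ E i := Nat.cast_nonneg _
      linarith
    · rw [hxge i h]; positivity
  · rcases lt_or_ge i d with h | h
    · rw [hxlt i h]; have : (0 : ℝ) ≤ E i := Nat.cast_nonneg _
      linarith
    · rw [hxge i h]; positivity
  · rcases lt_or_ge i d with h | h
    · rw [← sum_range_add_sum_Ico _ (durfee_le_rowLen h), hxlt i h]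
      have h1 : ∑ j ∈ range d, x j = d * (t ^ 2 - N) + μ.legProduct := by
        rw [sum_congr rfl fun j hj => hxlt j (mem_range.1 hj), sum_add_distrib, ← hEP]
        simp
        ring
      have h2 : ∑ j ∈ Ico d (μ.rowLen i), x j = t * E i := by
        rw [sum_congr rfl fun j hj => hxge j (mem_Ico.1 hj).1, ← mul_sum, hE]
        simp
      rw [h1, h2]
      linarith
    · rw [hxge i h]
      calc ∑ j ∈ range (μ.rowLen i), x j ≤ ∑ j ∈ range (μ.rowLen i), t ^ 2 := by
            refine sum_le_sum fun j hj => ?_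
            rw [hxlt j ((mem_range.1 hj).trans_le (rowLen_le_durfee h))]
            have : (E j : ℝ) ≤ N := by exact_mod_cast hEN j
            linarith
        _ = t * (t * μ.rowLen i) := by simp; ring

/-- The number of cells in the shorter leg. -/
noncomputable def minLeg (μ : YoungDiagram) : ℕ := min μ.lowerLeg μ.rightLeg

/-- Transposition swaps the legs and preserves `d` and the leg product, so the shorter leg may play
the role of the lower one. -/
theorem hasGrowth_of_legProduct_le (μ : YoungDiagram) {t : ℝ} (ht : 0 < t)
    (hN : (μ.minLeg : ℝ) < t ^ 2)
    (hP : (μ.legProduct : ℝ) ≤ (t - μ.durfee) * (t ^ 2 - μ.minLeg)) : μ.HasGrowth t := by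
  rcases le_total μ.lowerLeg μ.rightLeg with h | h
  · rw [minLeg, min_eq_left h] at hN hP
    obtain ⟨x, hx⟩ := μ.exists_supersolution ht hN hP
    exact hx.hasGrowth ht
  · rw [minLeg, min_eq_right h] at hN hP
    obtain ⟨x, hx⟩ := μ.transpose.exists_supersolution ht (by rwa [lowerLeg_transpose])
      (by rwa [lowerLeg_transpose, legProduct_transpose, durfee_transpose])
    exact hx.hasGrowth_of_transpose ht

/-! ### Bounds for the leg product. -/

theorem legProduct_le_durfee_mul_minLeg (μ : YoungDiagram) :
    μ.legProduct ≤ μ.durfee * μ.minLeg := by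
  rw [minLeg, ← Nat.mul_min_mul_left, le_min_iff]
  simp only [lowerLeg, rightLeg, legProduct, mul_sum]
  constructor
  · exact sum_le_sum fun j hj => Nat.mul_le_mul_right _ (colLen_le_durfee (mem_Ico.1 hj).1)
  · refine sum_le_sum fun j hj => ?_
    rw [mul_comm]
    exact Nat.mul_le_mul_right _ (rowLen_le_durfee (mem_Ico.1 hj).1)

theorem legProduct_le_mul (μ : YoungDiagram) : μ.legProduct ≤ μ.rightLeg * μ.lowerLeg := by
  rw [legProduct, rightLeg, lowerLeg, sum_mul_sum]
  exact sum_le_sum fun j hj =>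
    single_le_sum (f := fun i => μ.colLen j * μ.rowLen i) (fun _ _ => Nat.zero_le _) hj

/-- An antitone family in `[0, B]` of total `s B + w` with `w ≤ B` has its largest sum of squares
when all but one of its members are `0` or `B`. -/
theorem sum_sq_le_of_antitone {x : ℕ → ℝ} (hx : Antitone x) (hx0 : ∀ i, 0 ≤ x i) {B w : ℝ}
    (hB : ∀ i, x i ≤ B) (hw : 0 ≤ w) (hwB : w ≤ B) {s n : ℕ} (hsn : s ≤ n)
    (hsum : ∑ i ∈ range n, x i = s * B + w) :
    ∑ i ∈ range n, x i ^ 2 ≤ s * B ^ 2 + w ^ 2 := by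
  rw [← sum_range_add_sum_Ico _ hsn] at hsum ⊢
  set T := ∑ i ∈ range s, x i
  have hT : T ≤ s * B := by
    simpa using sum_le_sum fun i (_ : i ∈ range s) => hB i
  -- For `i < s` this is `(B - x i)(x i - x s) ≥ 0`. Together with `h2` the total is at most `B T +
  -- x s * w`, since the tail sum exceeds `w` by exactly the deficit `s B - T`.
  have h1 : ∑ i ∈ range s, x i ^ 2 ≤ ∑ i ∈ range s, (B * x i - x s * (B - x i)) := by
    refine sum_le_sum fun i hi => ?_
    have := mul_nonneg (sub_nonneg.2 (hB i)) (sub_nonneg.2 (hx (mem_range.1 hi).le))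
    linarith
  have h2 : ∑ i ∈ Ico s n, x i ^ 2 ≤ ∑ i ∈ Ico s n, x s * x i := by
    refine sum_le_sum fun i hi => ?_
    rw [sq]
    exact mul_le_mul_of_nonneg_right (hx (mem_Ico.1 hi).1) (hx0 i)
  have h3 : ∑ i ∈ range s, (B * x i - x s * (B - x i)) = B * T - x s * (s * B - T) := by
    simp [sum_sub_distrib, ← mul_sum, T]
  rw [← mul_sum] at h2
  rcases eq_or_lt_of_le hsn with rfl | hlt
  · simp only [Ico_self, sum_empty, add_zero, mul_zero] at *
    have : x s * (s * B - T) ≥ 0 := mul_nonneg (hx0 s) (by linarith)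
    nlinarith [sq_nonneg w]
  · have h4 : x s ≤ ∑ i ∈ Ico s n, x i :=
      single_le_sum (fun i _ => hx0 i) (mem_Ico.2 ⟨le_rfl, hlt⟩)
    set U := ∑ i ∈ Ico s n, x i
    have hδ : 0 ≤ s * B - T := by linarith
    have hU : U = w + (s * B - T) := by linarith
    have h5 : x s * w ≤ (w + (s * B - T)) * w := mul_le_mul_of_nonneg_right (by linarith) hw
    have h6 : (s * B - T) * w ≤ (s * B - T) * B := mul_le_mul_of_nonneg_left hwB hδ
    rw [hU] at h2
    linarith

end YoungDiagram

namespace YoungDiagram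

open Finset

/-- Since `4ab ≤ (a + b)²`, it suffices to bound the squares of the sums `colLen + rowLen`, an
antitone sequence in `[0, 2d]` of known total. -/
theorem four_mul_legProduct_le (μ : YoungDiagram) {s w : ℕ}
    (h : μ.lowerLeg + μ.rightLeg = 2 * μ.durfee * s + w) (hw : w ≤ 2 * μ.durfee) :
    (4 * μ.legProduct : ℝ) ≤ 4 * μ.durfee ^ 2 * s + w ^ 2 := by
  set d := μ.durfee with hd
  set n := μ.sideBound - d with hn
  set x : ℕ → ℝ := fun i => μ.colLen (d + i) + μ.rowLen (d + i) with hx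
  have hext : ∀ i, n ≤ i → μ.colLen (d + i) = 0 ∧ μ.rowLen (d + i) = 0 := fun i hi => by
    have h1 : μ.sideBound ≤ d + i := by omega
    refine ⟨?_, rowLen_eq_zero_of_sideBound_le h1⟩
    rw [← rowLen_transpose]
    exact rowLen_eq_zero_of_sideBound_le (by rwa [sideBound_transpose])
  -- Padding by `s` zero terms guarantees that the family has at least `s` members.
  have hsum : ∀ f : ℝ → ℝ, f 0 = 0 →
      ∑ i ∈ range (n + s), f (x i) = ∑ i ∈ range n, f (x i) := fun f hf => by
    refine (sum_subset (range_subset_range.2 (Nat.le_add_right n s)) fun i _ hi => ?_).symm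
    simp [hx, hext i (by simpa using hi), hf]
  have key := sum_sq_le_of_antitone (x := x) (B := 2 * d) (w := w) (s := s) (n := n + s)
    (fun i j hij => by
      have h1 := μ.colLen_anti (d + i) (d + j) (by omega)
      have h2 := μ.rowLen_anti (d + i) (d + j) (by omega)
      simp only [hx]
      gcongr)
    (fun i => by positivity)
    (fun i => by
      have h1 : μ.colLen (d + i) ≤ d := colLen_le_durfee (Nat.le_add_right _ _)
      have h2 : μ.rowLen (d + i) ≤ d := rowLen_le_durfee (Nat.le_add_right _ _)
      simp only [hx]
      have : μ.colLen (d + i) + μ.rowLen (d + i) ≤ 2 * d := by omega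
      exact_mod_cast this)
    (Nat.cast_nonneg w) (by exact_mod_cast hw) (Nat.le_add_left s n) (by
      rw [hsum (fun y => y) rfl]
      have : ∑ i ∈ range n, (μ.colLen (d + i) + μ.rowLen (d + i)) = s * (2 * d) + w := by
        rw [sum_add_distrib, mul_comm s, ← h, lowerLeg, rightLeg, sum_Ico_eq_sum_range,
          sum_Ico_eq_sum_range, add_comm]
      simp only [hx]
      exact_mod_cast this)
  rw [hsum (fun y => y ^ 2) (by simp)] at key
  have h4 : (4 * μ.legProduct : ℝ) ≤ ∑ i ∈ range n, x i ^ 2 := by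
    rw [legProduct, sum_Ico_eq_sum_range, Nat.cast_sum, mul_sum]
    refine sum_le_sum fun i _ => ?_
    simp only [hx, Nat.cast_mul]
    nlinarith [sq_nonneg ((μ.colLen (d + i) : ℝ) - μ.rowLen (d + i))]
  calc (4 * μ.legProduct : ℝ) ≤ s * (2 * d) ^ 2 + w ^ 2 := h4.trans key
    _ = 4 * d ^ 2 * s + w ^ 2 := by ring

/-! ### Growth rates for diagrams with `m² + l` cells. -/

theorem HasGrowth.mono {μ : YoungDiagram} {s t : ℝ} (hs : 0 ≤ s) (hst : s ≤ t)
    (h : μ.HasGrowth s) : μ.HasGrowth t := by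
  obtain ⟨K, hK⟩ := h
  have hK0 : 0 ≤ K := by simpa using (Nat.cast_nonneg _).trans (hK 0 0)
  exact ⟨K, fun n i => (hK n i).trans (by gcongr)⟩

theorem two_mul_minLeg_le (μ : YoungDiagram) : 2 * μ.minLeg + μ.durfee ^ 2 ≤ μ.card := by
  have := μ.card_eq_durfee_add_legs
  have h1 : μ.minLeg ≤ μ.lowerLeg := min_le_left _ _
  have h2 : μ.minLeg ≤ μ.rightLeg := min_le_right _ _
  omega

theorem minLeg_eq_zero_of_durfee_eq_zero {μ : YoungDiagram} (h : μ.durfee = 0) :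
    μ.minLeg = 0 := by
  have h1 : μ.lowerLeg = 0 := sum_eq_zero fun j _ =>
    Nat.le_zero.1 ((rowLen_le_durfee (h.trans_le j.zero_le)).trans_eq h)
  simp [minLeg, h1]

theorem legProduct_le_minLeg_mul {μ : YoungDiagram} {e : ℕ} (h : μ.card = μ.durfee ^ 2 + e) :
    (μ.legProduct : ℝ) ≤ μ.minLeg * (e - μ.minLeg) := by
  have h1 : (μ.legProduct : ℝ) ≤ μ.rightLeg * μ.lowerLeg := by exact_mod_cast μ.legProduct_le_mul
  have h2 : (e : ℝ) = μ.lowerLeg + μ.rightLeg := by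
    have := μ.card_eq_durfee_add_legs
    exact_mod_cast (show e = μ.lowerLeg + μ.rightLeg by omega)
  refine h1.trans_eq ?_
  rcases le_total μ.lowerLeg μ.rightLeg with hl | hl
  · rw [minLeg, min_eq_left hl, h2]; ring
  · rw [minLeg, min_eq_right hl, h2]; ring

/-- The hypothesis gives `N ≤ t(t - d)` for the shorter leg `N`, and with `P ≤ dN` this is what the
leg criterion asks. -/
theorem hasGrowth_of_card_le (μ : YoungDiagram) {t : ℝ} (ht : 0 < t)
    (h : (μ.card : ℝ) - μ.durfee ^ 2 ≤ 2 * t * (t - μ.durfee)) : μ.HasGrowth t := by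
  have h1 : (2 * μ.minLeg + μ.durfee ^ 2 : ℝ) ≤ μ.card := by exact_mod_cast μ.two_mul_minLeg_le
  have h2 : (μ.legProduct : ℝ) ≤ μ.durfee * μ.minLeg := by
    exact_mod_cast μ.legProduct_le_durfee_mul_minLeg
  have hN : (μ.minLeg : ℝ) ≤ t * (t - μ.durfee) := by linarith
  refine μ.hasGrowth_of_legProduct_le ht ?_ ?_
  · rcases Nat.eq_zero_or_pos μ.durfee with h0 | h0
    · rw [minLeg_eq_zero_of_durfee_eq_zero h0, Nat.cast_zero]; positivity
    · have : (0 : ℝ) < t * μ.durfee := mul_pos ht (Nat.cast_pos.2 h0)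
      nlinarith
  · nlinarith [mul_le_mul_of_nonneg_left hN ht.le]

theorem durfee_le_of_card_lt {μ : YoungDiagram} {m : ℕ} (h : μ.card < (m + 1) ^ 2) :
    μ.durfee ≤ m := by
  have := μ.card_eq_durfee_add_legs
  exact Nat.lt_succ_iff.1
    (lt_of_pow_lt_pow_left₀ 2 (Nat.zero_le _) (by rw [Nat.succ_eq_add_one]; omega))

theorem hasGrowth_of_card_eq_sq_add (μ : YoungDiagram) {m l : ℕ} (hl : 1 ≤ l) (hlm : l ≤ 2 * m)
    (h : μ.card = m ^ 2 + l) : μ.HasGrowth (((m : ℝ) + √((m : ℝ) ^ 2 + 2 * l)) / 2) := by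
  set t : ℝ := ((m : ℝ) + √((m : ℝ) ^ 2 + 2 * l)) / 2 with ht
  have hs : √((m : ℝ) ^ 2 + 2 * l) ^ 2 = (m : ℝ) ^ 2 + 2 * l := Real.sq_sqrt (by positivity)
  have hsm : (m : ℝ) ≤ √((m : ℝ) ^ 2 + 2 * l) :=
    Real.le_sqrt_of_sq_le (le_add_of_nonneg_right (by positivity))
  have hd : μ.durfee ≤ m := durfee_le_of_card_lt (by rw [h]; nlinarith)
  have hd' : (μ.durfee : ℝ) ≤ m := by exact_mod_cast hd
  have hm : (0 : ℝ) < m := by exact_mod_cast (show 0 < m by omega)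
  have htm : (m : ℝ) ≤ t := by rw [ht]; linarith
  have ht2 : 2 * t * (t - m) = l := by rw [ht]; linarith
  refine μ.hasGrowth_of_card_le (hm.trans_le htm) ?_
  rw [h]
  push_cast
  -- As `l = 2t(t - m)`, the slack is `(m - d)(2t - m - d)`, with equality at `d = m`.
  nlinarith [mul_nonneg (sub_nonneg.2 hd') (show (0 : ℝ) ≤ 2 * t - m - μ.durfee by linarith)]

/-- If `d = m`, the single extra cell leaves one leg empty and the leg product vanishes; if `d < m`,
the crude criterion only needs `1 ≤ (m - d)²`. -/
theorem hasGrowth_of_card_eq_sq_add_one (μ : YoungDiagram) {m : ℕ} (hm : 1 ≤ m)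
    (h : μ.card = m ^ 2 + 1) : μ.HasGrowth m := by
  have hm' : (0 : ℝ) < m := by exact_mod_cast hm
  have hd : μ.durfee ≤ m := durfee_le_of_card_lt (by rw [h]; nlinarith)
  rcases hd.eq_or_lt with hdm | hlt
  · have h1 := μ.two_mul_minLeg_le
    rw [h, hdm] at h1
    have h2 : μ.minLeg = 0 := by omega
    have h3 := μ.legProduct_le_durfee_mul_minLeg
    rw [h2, mul_zero, Nat.le_zero] at h3
    refine μ.hasGrowth_of_legProduct_le hm' ?_ ?_
    · rw [h2, Nat.cast_zero]; positivity
    · rw [h3, hdm]; simp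
  · refine μ.hasGrowth_of_card_le hm' ?_
    have : (μ.durfee : ℝ) + 1 ≤ m := by exact_mod_cast hlt
    rw [h]
    push_cast
    nlinarith

/-- This `t` makes the crude criterion an equality at `d = m - 1`. For `d = m` the shorter leg has
at most `m - 2` cells, and the product bound leaves slack `t - m` in that extreme case. -/
theorem hasGrowth_of_card_eq_sq_add_two_mul_sub_three (μ : YoungDiagram) {m l : ℕ} (hl : 1 ≤ l)
    (hlm : l + 3 = 2 * m) (h : μ.card = m ^ 2 + l) :
    μ.HasGrowth (((m : ℝ) - 1 + √((m : ℝ) ^ 2 + 6 * m - 7)) / 2) := by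
  set t : ℝ := ((m : ℝ) - 1 + √((m : ℝ) ^ 2 + 6 * m - 7)) / 2 with ht
  have hm : (2 : ℝ) ≤ m := by exact_mod_cast (show 2 ≤ m by omega)
  have hs : √((m : ℝ) ^ 2 + 6 * m - 7) ^ 2 = (m : ℝ) ^ 2 + 6 * m - 7 :=
    Real.sq_sqrt (by nlinarith)
  have hsm : (m : ℝ) + 1 ≤ √((m : ℝ) ^ 2 + 6 * m - 7) := Real.le_sqrt_of_sq_le (by nlinarith)
  have htm : (m : ℝ) ≤ t := by rw [ht]; linarith
  have ht2 : t ^ 2 = (m - 1) * t + 2 * (m - 1) := by rw [ht]; linarith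
  have hlR : (l : ℝ) = 2 * m - 3 := by
    have : (l : ℝ) + 3 = 2 * m := by exact_mod_cast hlm
    linarith
  have hd : μ.durfee ≤ m := durfee_le_of_card_lt (by rw [h]; nlinarith)
  rcases hd.eq_or_lt with hdm | hlt
  · have h1 := μ.two_mul_minLeg_le
    rw [h, hdm] at h1
    have hN : (μ.minLeg : ℝ) + 2 ≤ m := by exact_mod_cast (show μ.minLeg + 2 ≤ m by omega)
    have hP := legProduct_le_minLeg_mul (h.trans (by rw [hdm]))
    have hN0 : (0 : ℝ) ≤ μ.minLeg := Nat.cast_nonneg _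
    refine μ.hasGrowth_of_legProduct_le (by linarith) (by nlinarith) (hP.trans ?_)
    rw [hdm, hlR]
    set N : ℝ := (μ.minLeg : ℝ)
    have e1 : (t - m) * (t ^ 2 - (m - 2)) = (m - 1) * (m - 2) + (t - m) := by
      have : t ^ 3 = t * ((m - 1) * t + 2 * (m - 1)) := by rw [← ht2]; ring
      nlinarith
    have e2 : (t - m) * (t ^ 2 - (m - 2)) ≤ (t - m) * (t ^ 2 - N) :=
      mul_le_mul_of_nonneg_left (by linarith) (by linarith)
    nlinarith [mul_nonneg (show 0 ≤ m - 2 - N by linarith) (show 0 ≤ m - 1 - N by linarith)]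
  · have hd' : (μ.durfee : ℝ) + 1 ≤ m := by exact_mod_cast hlt
    refine μ.hasGrowth_of_card_le (by linarith) ?_
    rw [h]
    push_cast
    rw [hlR]
    nlinarith [mul_nonneg (show (0 : ℝ) ≤ m - 1 - μ.durfee by linarith)
      (show (0 : ℝ) ≤ 2 * t - (m - 1) - μ.durfee by linarith)]

/-- Put `r = m - d`. The crude criterion settles `l ≤ r²`. Otherwise `r ≤ l`, so `d` is large
compared with `l²`; convexity gives `P ≤ d² r + l²`, and the term `d r²` in `r(m² - N)` absorbs the
errors. -/
theorem hasGrowth_of_durfee_lt (μ : YoungDiagram) {m l : ℕ} (hM : 2 * l ^ 2 + 2 * l + 1 ≤ m)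
    (h : μ.card = m ^ 2 + l) (hd : μ.durfee < m) : μ.HasGrowth m := by
  obtain ⟨s, hs⟩ := Nat.exists_eq_add_of_lt hd
  replace hs : m = μ.durfee + (s + 1) := by omega
  set r := s + 1 with hr
  have hsR : (m : ℝ) = μ.durfee + r := by exact_mod_cast hs
  have hm : (0 : ℝ) < m := by exact_mod_cast (show 0 < m by omega)
  have hr1 : (1 : ℝ) ≤ r := by exact_mod_cast (show 1 ≤ r by omega)
  have hd0 : (0 : ℝ) ≤ μ.durfee := Nat.cast_nonneg _
  rcases le_or_gt l (r ^ 2) with hls | hls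
  · have hls' : (l : ℝ) ≤ r ^ 2 := by exact_mod_cast hls
    refine μ.hasGrowth_of_card_le hm ?_
    rw [h]
    push_cast
    rw [hsR]
    nlinarith
  · have hrl : r ≤ l := by nlinarith
    have hdl : 2 * l ^ 2 + l + 1 ≤ μ.durfee := by omega
    have hdl' : (2 * l ^ 2 + l + 1 : ℝ) ≤ μ.durfee := by exact_mod_cast hdl
    have hrl' : (r : ℝ) ≤ l := by exact_mod_cast hrl
    have hls' : (r : ℝ) ^ 2 ≤ l := by exact_mod_cast hls.le
    have hlegs : μ.lowerLeg + μ.rightLeg = 2 * μ.durfee * r + (r ^ 2 + l) := by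
      have := μ.card_eq_durfee_add_legs
      rw [h] at this
      have e : m ^ 2 = μ.durfee ^ 2 + 2 * μ.durfee * r + r ^ 2 := by rw [hs]; ring
      omega
    have hP := μ.four_mul_legProduct_le hlegs (by nlinarith)
    have h1 : (2 * μ.minLeg + μ.durfee ^ 2 : ℝ) ≤ m ^ 2 + l := by
      have := μ.two_mul_minLeg_le
      rw [h] at this
      exact_mod_cast this
    push_cast at hP
    set d : ℝ := (μ.durfee : ℝ)
    have hN : (μ.minLeg : ℝ) ≤ d * r + l := by rw [hsR] at h1; nlinarith
    have hdr : d ≤ d * r := by nlinarith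
    refine μ.hasGrowth_of_legProduct_le hm (by rw [hsR]; nlinarith) ?_
    have hw : ((r : ℝ) ^ 2 + l) ^ 2 ≤ 4 * l ^ 2 := by
      have : (r : ℝ) ^ 2 + l ≤ 2 * l := by linarith
      nlinarith [sq_nonneg (r : ℝ)]
    have e : (m : ℝ) - d = r := by rw [hsR]; ring
    rw [e]
    calc (μ.legProduct : ℝ) ≤ d ^ 2 * r + l ^ 2 := by linarith
      _ ≤ r * (m ^ 2 - (d * r + l)) := by
        rw [hsR]
        have a1 : (l : ℝ) * r ≤ l * l := mul_le_mul_of_nonneg_left hrl' (by positivity)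
        have a2 : d ≤ d * r * r := by nlinarith
        have a3 : (0 : ℝ) ≤ (r : ℝ) ^ 3 := by positivity
        nlinarith
      _ ≤ r * (m ^ 2 - μ.minLeg) := by gcongr

theorem hasGrowth_of_root (μ : YoungDiagram) {m l : ℕ} (hM : 2 * l ^ 2 + 2 * l + 1 ≤ m)
    (h : μ.card = m ^ 2 + l) {t : ℝ} (hmt : m ≤ t)
    (ht : (t - m) * (t ^ 2 - (l / 2 : ℕ)) = (l / 2 : ℕ) * ((l + 1) / 2 : ℕ)) : μ.HasGrowth t := by
  have hm1 : (2 * l ^ 2 + 2 * l + 1 : ℝ) ≤ m := by exact_mod_cast hM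
  have hd : μ.durfee ≤ m := durfee_le_of_card_lt (by rw [h]; nlinarith)
  rcases hd.eq_or_lt with hdm | hlt
  · have h1 := μ.two_mul_minLeg_le
    rw [h, hdm] at h1
    set p := l / 2 with hp
    set q := (l + 1) / 2 with hq
    have hpq : (p : ℝ) + q = l := by exact_mod_cast (show p + q = l by omega)
    have hpq' : (p : ℝ) ≤ q := by exact_mod_cast (show p ≤ q by omega)
    have hN : (μ.minLeg : ℝ) ≤ p := by exact_mod_cast (show μ.minLeg ≤ p by omega)
    have hP := legProduct_le_minLeg_mul (h.trans (by rw [hdm]))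
    have hl0 : (0 : ℝ) ≤ l := Nat.cast_nonneg _
    refine μ.hasGrowth_of_legProduct_le (by nlinarith) (by nlinarith) (hP.trans ?_)
    rw [hdm, ← hpq]
    have e2 : (t - m) * (t ^ 2 - p) ≤ (t - m) * (t ^ 2 - μ.minLeg) :=
      mul_le_mul_of_nonneg_left (by linarith) (by linarith)
    -- `N(p + q - N) ≤ pq` is `(p - N)(q - N) ≥ 0`.
    nlinarith [mul_nonneg (sub_nonneg.2 hN) (sub_nonneg.2 (hN.trans hpq'))]
  · exact (μ.hasGrowth_of_durfee_lt hM h hlt).mono (Nat.cast_nonneg m) hmt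

end YoungDiagram

namespace EntropyBounds

/-! ### The cubic and the comparison with `√k`. -/

/-- For `m² > p` the cubic `(t - m) (t² - p) - p q` has a largest positive root, and this root is
at least `m`. -/
theorem exists_isLargestPositiveRoot {m p : ℕ} (q : ℕ) (hm : 1 ≤ m) (hp : p < m ^ 2) :
    ∃ ρ : ℝ, IsLargestPositiveRoot m p q ρ ∧ (m : ℝ) ≤ ρ ∧ (ρ - m) * (ρ ^ 2 - p) = p * q := by
  have hm' : (1 : ℝ) ≤ m := by exact_mod_cast hm
  have hp' : (p : ℝ) + 1 ≤ m ^ 2 := by exact_mod_cast hp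
  have hpq : (0 : ℝ) ≤ p * q := by positivity
  set f : ℝ → ℝ := fun t => (t - m) * (t ^ 2 - p) with hf
  obtain ⟨ρ, ⟨hmρ, -⟩, hρ⟩ : (p * q : ℝ) ∈ f '' Set.Icc (m : ℝ) (m + p * q) := by
    refine intermediate_value_Icc (by linarith) (by fun_prop) ⟨by simpa [hf] using hpq, ?_⟩
    simp only [hf, add_sub_cancel_left]
    exact le_mul_of_one_le_right hpq (by nlinarith)
  have hρ' : (ρ - m) * (ρ ^ 2 - p) = p * q := hρ
  refine ⟨ρ, ⟨⟨by linarith, by linarith⟩, fun t ⟨_, ht⟩ => ?_⟩, hmρ, hρ'⟩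
  by_contra! hlt
  have h1 : (t - m) * (t ^ 2 - p) = p * q := by linarith
  have h2 : ρ ^ 2 < t ^ 2 := by nlinarith
  have h3 : (m : ℝ) ^ 2 ≤ ρ ^ 2 := by nlinarith
  nlinarith [mul_pos (sub_pos.2 hlt) (show 0 < t ^ 2 - p by linarith),
    mul_nonneg (sub_nonneg.2 hmρ) (sub_nonneg.2 h2.le)]

/-- The left side is the mean of two distinct numbers whose squares have mean `m² + l`; squaring is
strictly convex. -/
theorem half_add_sqrt_lt_sqrt {m l : ℕ} (hl : 1 ≤ l) :
    ((m : ℝ) + √((m : ℝ) ^ 2 + 2 * l)) / 2 < √((m : ℝ) ^ 2 + l) := by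
  have hl' : (1 : ℝ) ≤ l := by exact_mod_cast hl
  have hs : √((m : ℝ) ^ 2 + 2 * l) ^ 2 = (m : ℝ) ^ 2 + 2 * l := Real.sq_sqrt (by positivity)
  have hsm : (m : ℝ) < √((m : ℝ) ^ 2 + 2 * l) := Real.lt_sqrt_of_sq_lt (by linarith)
  refine Real.lt_sqrt_of_sq_lt ?_
  nlinarith [mul_pos (sub_pos.2 hsm) (sub_pos.2 hsm)]

end EntropyBounds

namespace EntropyBounds

open Finset

/-! ### From digraphs to Young diagrams. -/

/-- The number of walks `x = x₀, x₁, …, xₙ` in the digraph with out-neighbourhoods `nbr`. -/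
def digraphWalkCount {X : Type*} (nbr : X → Finset X) : ℕ → X → ℕ
  | 0, _ => 1
  | n + 1, x => ∑ y ∈ nbr x, digraphWalkCount nbr n y

/-- The words of the walks `x = x₀, x₁, …, xₙ` in the digraph with out-neighbourhoods `nbr`. -/
def walkWords {X : Type*} [DecidableEq X] (nbr : X → Finset X) : ℕ → X → Finset (List X)
  | 0, x => {[x]}
  | n + 1, x => (nbr x).biUnion fun y => (walkWords nbr n y).image (List.cons x)

theorem card_walkWords_le {X : Type*} [DecidableEq X] (nbr : X → Finset X) (n : ℕ) (x : X) :
    #(walkWords nbr n x) ≤ digraphWalkCount nbr n x := by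
  induction n generalizing x with
  | zero => simp [walkWords, digraphWalkCount]
  | succ n ih =>
    exact card_biUnion_le.trans (sum_le_sum fun y _ => card_image_le.trans (ih y))

theorem mem_walkWords_of_isChain {X : Type*} [DecidableEq X] {nbr : X → Finset X} (x : X)
    (l : List X) (h : (x :: l).IsChain fun a b => b ∈ nbr a) :
    x :: l ∈ walkWords nbr l.length x := by
  induction l generalizing x with
  | nil => simp [walkWords]
  | cons y l ih =>
    rw [List.isChain_cons_cons] at h
    exact mem_biUnion.2 ⟨y, h.1, mem_image_of_mem _ (ih y h.2)⟩

/-- The largest element of a set of `n + 1` naturals is at least `n`; remove it and induct. -/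
theorem sum_le_sum_range_card {v : ℕ → ℕ} (hv : Antitone v) (s : Finset ℕ) :
    ∑ i ∈ s, v i ≤ ∑ i ∈ range #s, v i := by
  induction hn : #s generalizing s with
  | zero => simp [card_eq_zero.1 hn]
  | succ n ih =>
    have hne : s.Nonempty := card_pos.1 (by omega)
    have hmax := s.max'_mem hne
    rw [← sum_erase_add _ _ hmax, sum_range_succ]
    refine add_le_add (ih _ (by rw [card_erase_of_mem hmax, hn]; rfl)) (hv ?_)
    have : s ⊆ range (s.max' hne + 1) := fun i hi =>
      mem_range.2 (Nat.lt_succ_of_le (s.le_max' i hi))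
    have := card_le_card this
    rw [hn, card_range] at this
    omega

theorem _root_.YoungDiagram.walkCount_antitone (μ : YoungDiagram) (n : ℕ) :
    Antitone (μ.walkCount n) := by
  intro i j hij
  cases n with
  | zero => exact le_rfl
  | succ n => exact sum_le_sum_of_subset (range_subset_range.2 (μ.rowLen_anti i j hij))

/-- The walks in a finite digraph are dominated by those in the Young diagram of its
out-degrees. -/
theorem exists_youngDiagram_walkCount {X : Type*} [Fintype X] (nbr : X → Finset X) :
    ∃ μ : YoungDiagram, μ.card = ∑ x, #(nbr x) ∧
      ∀ n, ∑ x, digraphWalkCount nbr n x ≤ ∑ i ∈ range (Fintype.card X), μ.walkCount n i := by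
  set N := Fintype.card X with hN
  obtain ⟨e, he⟩ : ∃ e : Fin N ≃ X, Antitone fun i => #(nbr (e i)) := by
    let e₀ := (Fintype.equivFin X).symm
    let f : Fin N → ℕᵒᵈ := fun i => OrderDual.toDual #(nbr (e₀ i))
    exact ⟨(Tuple.sort f).trans e₀, fun i j hij => Tuple.monotone_sort f hij⟩
  let r : ℕ → ℕ := fun i => if h : i < N then #(nbr (e ⟨i, h⟩)) else 0
  have hr : ∀ i : Fin N, r i = #(nbr (e i)) := fun i => by simp [r]
  have hr0 : ∀ i, N ≤ i → r i = 0 := fun i hi => by simp [r, hi]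
  have hrN : ∀ i, r i ≤ N := fun i => by
    simp only [r]
    split_ifs with h
    · exact card_le_univ _
    · exact Nat.zero_le _
  have hra : Antitone r := fun i j hij => by
    rcases lt_or_ge j N with h | h
    · have := he (show (⟨i, hij.trans_lt h⟩ : Fin N) ≤ ⟨j, h⟩ from hij)
      simpa [r, h, hij.trans_lt h] using this
    · rw [hr0 j h]; exact Nat.zero_le _
  let μ : YoungDiagram :=
    { cells := (range N ×ˢ range N).filter fun c => c.2 < r c.1
      isLowerSet := by
        rintro ⟨i, j⟩ ⟨i', j'⟩ ⟨h1, h2⟩ h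
        simp only [coe_filter, mem_product, mem_range, Set.mem_ofPred_eq] at h h1 h2 ⊢
        have := hra h1
        omega }
  have hμ : ∀ i, μ.rowLen i = r i := fun i => by
    refine eq_of_forall_lt_iff fun j => ?_
    rw [← YoungDiagram.mem_iff_lt_rowLen, ← YoungDiagram.mem_cells]
    simp only [μ, mem_filter, mem_product, mem_range]
    refine ⟨fun h => h.2, fun h => ⟨⟨?_, h.trans_le (hrN i)⟩, h⟩⟩
    by_contra! hi
    rw [hr0 i hi] at h
    omega
  refine ⟨μ, ?_, fun n => ?_⟩
  · rw [μ.card_eq_sum_rowLen (N := N) fun i hi => (hμ i).trans (hr0 i hi), ← Fin.sum_univ_eq_sum_range,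
      ← e.sum_comp]
    exact sum_congr rfl fun i _ => (hμ i).trans (hr i)
  · rw [← Fin.sum_univ_eq_sum_range, ← e.sum_comp]
    refine sum_le_sum fun i _ => ?_
    induction n generalizing i with
    | zero => exact le_rfl
    | succ n ih =>
      classical
      let s : Finset ℕ := (nbr (e i)).image fun y => (e.symm y : ℕ)
      have hinj : Function.Injective fun y => (e.symm y : ℕ) :=
        Fin.val_injective.comp e.symm.injective
      have hs : #s = μ.rowLen i := by
        rw [hμ, hr]
        exact card_image_of_injective _ hinj
      -- The neighbours become a set of `rowLen i` indices; antitone walk counts make the initial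
      -- segment of that size the best choice.
      calc digraphWalkCount nbr (n + 1) (e i)
          = ∑ y ∈ nbr (e i), digraphWalkCount nbr n y := rfl
        _ ≤ ∑ y ∈ nbr (e i), μ.walkCount n (e.symm y) :=
            sum_le_sum fun y _ => by simpa using ih (e.symm y)
        _ = ∑ j ∈ s, μ.walkCount n j := by
            rw [sum_image fun a _ b _ h => hinj h]
        _ ≤ ∑ j ∈ range #s, μ.walkCount n j := sum_le_sum_range_card (μ.walkCount_antitone n) s
        _ = μ.walkCount (n + 1) i := by rw [hs]; rfl

/-! ### Normal words. -/

/-- In a finite family indexed by a linear order, the members outside the span of the earlier ones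
form a basis of the span of the whole family. -/
theorem finrank_span_range_eq_card {F V ι : Type*} [Field F] [AddCommGroup V] [Module F V]
    [Fintype ι] [LinearOrder ι] (f : ι → V) (s : Finset ι)
    (hs : ∀ i, i ∈ s ↔ f i ∉ Submodule.span F (f '' Set.Iio i)) :
    Module.finrank F (Submodule.span F (Set.range f)) = #s := by
  have hspan : Submodule.span F (Set.range f) = Submodule.span F (Set.range fun i : s => f i) := by
    refine le_antisymm (Submodule.span_le.2 ?_) (Submodule.span_mono ?_)
    · rintro _ ⟨i, rfl⟩
      induction i using WellFoundedLT.induction with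
      | ind i ih =>
        by_cases hi : i ∈ s
        · exact Submodule.subset_span ⟨⟨i, hi⟩, rfl⟩
        · have := not_not.1 (mt (hs i).2 hi)
          refine Submodule.span_le.2 ?_ this
          rintro _ ⟨j, hj, rfl⟩
          exact ih j hj
    · rintro _ ⟨i, rfl⟩
      exact ⟨i, rfl⟩
  have hli : LinearIndependent F fun i : s => f i := by
    classical
    rw [Fintype.linearIndependent_iff]
    intro g hg
    by_contra! hne
    obtain ⟨i₀, hi₀⟩ := hne
    obtain ⟨i, hi, hmax⟩ := exists_max_image (univ.filter fun i : s => g i ≠ 0) id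
      ⟨i₀, by simpa using hi₀⟩
    have hgi : g i ≠ 0 := by simpa using hi
    refine (hs i).1 i.2 ?_
    rw [← add_sum_erase _ _ (mem_univ i), add_eq_zero_iff_eq_neg] at hg
    have : g i • f i ∈ Submodule.span F (f '' Set.Iio (i : ι)) := by
      rw [hg]
      refine Submodule.neg_mem _ (Submodule.sum_mem _ fun j hj => ?_)
      by_cases hgj : g j = 0
      · rw [hgj, zero_smul]; exact Submodule.zero_mem _
      · refine Submodule.smul_mem _ _ (Submodule.subset_span ⟨j, ?_, rfl⟩)
        have := hmax j (by simpa using hgj)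
        exact lt_of_le_of_ne this (Subtype.coe_ne_coe.2 (ne_of_mem_erase hj))
    simpa [smul_smul, inv_mul_cancel₀ hgi] using Submodule.smul_mem _ (g i)⁻¹ this
  rw [hspan, finrank_span_eq_card hli, Fintype.card_coe]

section Words

variable {F X : Type*} [Field F] (I : Ideal (FreeAlgebra F X)) [I.IsTwoSided]

/-- The image of a word in `F⟨X⟩ / I`. -/
def wordImage (l : List X) : FreeAlgebra F X ⧸ I :=
  Ideal.Quotient.mkₐ F I (l.map (FreeAlgebra.ι F)).prod

theorem wordImage_append (l l' : List X) :
    wordImage I (l ++ l') = wordImage I l * wordImage I l' := by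
  simp [wordImage]

theorem quotientPart_eq_span (n : ℕ) :
    quotientPart I n = Submodule.span F (wordImage I '' {l | l.length = n}) := by
  rw [quotientPart, degreePart_eq_span_words, Submodule.map_span]
  congr 1
  ext a
  simp only [Set.mem_image, Set.mem_ofPred_eq]
  constructor
  · rintro ⟨_, ⟨l, hl, rfl⟩, rfl⟩
    exact ⟨l, hl, rfl⟩
  · rintro ⟨l, hl, rfl⟩
    exact ⟨_, ⟨l, hl, rfl⟩, rfl⟩

variable [LinearOrder X]

/-- `x y` is a normal word: its image is not in the span of the images of the lexicographically
smaller words of length two. -/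
def IsNormalPair (x y : X) : Prop :=
  wordImage I [x, y] ∉ Submodule.span F
    ((fun c : X ×ₗ X => wordImage I [(ofLex c).1, (ofLex c).2]) '' Set.Iio (toLex (x, y)))

/-- Rewriting a non-normal pair inside a word yields lexicographically smaller words of the same
length. There are finitely many of these, so the rewriting terminates. -/
theorem wordImage_mem_span_isChain [Finite X] (n : ℕ) (l : List X) (hl : l.length = n) :
    wordImage I l ∈ Submodule.span F
      (wordImage I '' {l | l.length = n ∧ l.IsChain (IsNormalPair I)}) := by
  have : Finite {l : List X // l.length = n} := List.finite_length_eq X n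
  suffices ∀ l : {l : List X // l.length = n}, wordImage I l ∈ Submodule.span F
      (wordImage I '' {l | l.length = n ∧ l.IsChain (IsNormalPair I)}) from this ⟨l, hl⟩
  clear hl l
  intro l
  induction l using WellFoundedLT.induction with
  | ind l ih =>
    obtain ⟨l, hl⟩ := l
    by_cases hc : l.IsChain (IsNormalPair I)
    · exact Submodule.subset_span ⟨l, ⟨hl, hc⟩, rfl⟩
    · rw [List.isChain_iff_forall_rel_of_append_cons_cons] at hc
      push Not at hc
      obtain ⟨x, y, u, v, rfl, hxy⟩ := hc
      rw [IsNormalPair, not_not] at hxy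
      have hsplit : ∀ a b : X, wordImage I (u ++ a :: b :: v) =
          wordImage I u * wordImage I [a, b] * wordImage I v := fun a b => by
        rw [← wordImage_append, ← wordImage_append]; simp
      rw [hsplit]
      generalize wordImage I [x, y] = b at hxy
      induction hxy using Submodule.span_induction with
      | mem a ha =>
        obtain ⟨c, hc, rfl⟩ := ha
        have hlt : u ++ (ofLex c).1 :: (ofLex c).2 :: v < u ++ x :: y :: v := by
          refine List.append_left_lt ?_
          rcases Prod.Lex.lt_iff.1 hc with h | ⟨h1, h2⟩
          · exact List.Lex.rel h
          · simp only [ofLex_toLex] at h1 h2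
            rw [h1]
            exact List.Lex.cons (List.Lex.rel h2)
        have := ih ⟨_, by simpa using hl⟩ hlt
        rwa [hsplit] at this
      | zero => simp
      | add a b _ _ iha ihb => rw [mul_add, add_mul]; exact Submodule.add_mem _ iha ihb
      | smul c a _ iha =>
        rw [mul_smul_comm, smul_mul_assoc]; exact Submodule.smul_mem _ c iha

open Classical in
/-- The letters `y` such that `x y` is a normal word. -/
noncomputable def normalNbr [Fintype X] (x : X) : Finset X :=
  univ.filter (IsNormalPair I x)

/-- The normal pairs index the greedy basis of `A_2` for the lexicographic order on pairs. -/
theorem sum_card_normalNbr [Fintype X] : ∑ x, #(normalNbr I x) = hilbertFn I 2 := by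
  classical
  have h := finrank_span_range_eq_card (F := F)
    (fun c : X ×ₗ X => wordImage I [(ofLex c).1, (ofLex c).2])
    (univ.filter fun c => IsNormalPair I (ofLex c).1 (ofLex c).2) (fun c => by
      simp [IsNormalPair])
  have hr : Set.range (fun c : X ×ₗ X => wordImage I [(ofLex c).1, (ofLex c).2]) =
      wordImage I '' {l | l.length = 2} := by
    ext a
    constructor
    · rintro ⟨c, rfl⟩
      exact ⟨_, rfl, rfl⟩
    · rintro ⟨l, hl, rfl⟩
      obtain ⟨x, y, rfl⟩ := List.length_eq_two.1 hl
      exact ⟨toLex (x, y), rfl⟩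
  rw [hilbertFn, quotientPart_eq_span, ← hr, h, ← card_sigma]
  refine card_bij (fun c _ => toLex (c.1, c.2)) (fun c hc => ?_) (fun c _ c' _ h => ?_) fun c hc => ?_
  · simpa [normalNbr] using hc
  · have := Prod.ext_iff.1 (toLex.injective h)
    exact Sigma.ext this.1 (heq_of_eq this.2)
  · exact ⟨⟨(ofLex c).1, (ofLex c).2⟩, by simpa [normalNbr] using hc, rfl⟩

theorem hilbertFn_succ_le [Fintype X] (n : ℕ) :
    hilbertFn I (n + 1) ≤ ∑ x, digraphWalkCount (normalNbr I) n x := by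
  classical
  let S : Finset (FreeAlgebra F X ⧸ I) :=
    (univ.biUnion fun x => walkWords (normalNbr I) n x).image (wordImage I)
  have hle : quotientPart I (n + 1) ≤ Submodule.span F (S : Set (FreeAlgebra F X ⧸ I)) := by
    rw [quotientPart_eq_span, Submodule.span_le]
    rintro _ ⟨l, hl, rfl⟩
    refine Submodule.span_mono ?_ (wordImage_mem_span_isChain I (n + 1) l hl)
    rintro _ ⟨l, ⟨hl, hc⟩, rfl⟩
    obtain ⟨x, l, rfl⟩ := List.exists_cons_of_length_eq_add_one hl
    obtain rfl : l.length = n := by simpa using hl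
    refine mem_image_of_mem _ (mem_biUnion.2 ⟨x, mem_univ x, mem_walkWords_of_isChain x l ?_⟩)
    exact hc.imp fun a b h => by simpa [normalNbr] using h
  calc hilbertFn I (n + 1) ≤ Module.finrank F (Submodule.span F (S : Set (FreeAlgebra F X ⧸ I))) :=
        Submodule.finrank_mono hle
    _ ≤ #S := finrank_span_finset_le_card S
    _ ≤ ∑ x, #(walkWords (normalNbr I) n x) := card_image_le.trans card_biUnion_le
    _ ≤ _ := sum_le_sum fun x _ => card_walkWords_le _ n x

end Words

/-! ### Entropy bounds. -/

theorem limsup_rpow_le_of_le_geometric {a : ℕ → ℕ} {t K : ℝ} (ht : 0 < t)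
    (h : ∀ n, (a (n + 2) : ℝ) ≤ K * t ^ n) :
    Filter.limsup (fun n : ℕ => (a n : ℝ) ^ (1 / (n : ℝ))) Filter.atTop ≤ t := by
  -- The maximum with `1` keeps the constant positive, so its `n`-th roots tend to `1`.
  set L : ℝ := max 1 (K / t ^ 2)
  have hL : 0 < L := zero_lt_one.trans_le (le_max_left _ _)
  have hlim : Filter.Tendsto (fun n : ℕ => L ^ (1 / (n : ℝ)) * t) Filter.atTop (nhds t) := by
    have h1 : Filter.Tendsto (fun n : ℕ => L ^ (1 / (n : ℝ))) Filter.atTop (nhds (L ^ (0 : ℝ))) :=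
      (Real.continuousAt_const_rpow hL.ne').tendsto.comp tendsto_one_div_atTop_nhds_zero_nat
    simpa using h1.mul_const t
  have hle : ∀ᶠ n : ℕ in Filter.atTop,
      (a n : ℝ) ^ (1 / (n : ℝ)) ≤ L ^ (1 / (n : ℝ)) * t := by
    filter_upwards [Filter.eventually_ge_atTop 2] with n hn
    obtain ⟨k, rfl⟩ := Nat.exists_eq_add_of_le' hn
    have h1 : (a (k + 2) : ℝ) ≤ L * t ^ (k + 2) :=
      calc (a (k + 2) : ℝ) ≤ K * t ^ k := h k
        _ = K / t ^ 2 * t ^ (k + 2) := by field_simp; ring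
        _ ≤ L * t ^ (k + 2) := by gcongr; exact le_max_right _ _
    calc (a (k + 2) : ℝ) ^ (1 / ((k + 2 : ℕ) : ℝ))
        ≤ (L * t ^ (k + 2)) ^ (1 / ((k + 2 : ℕ) : ℝ)) :=
          Real.rpow_le_rpow (Nat.cast_nonneg _) h1 (by positivity)
      _ = L ^ (1 / ((k + 2 : ℕ) : ℝ)) * t := by
          rw [Real.mul_rpow hL.le (by positivity), one_div,
            Real.pow_rpow_inv_natCast ht.le (by omega)]
  rw [← hlim.limsup_eq]
  exact Filter.limsup_le_limsup hle
    (Filter.isCoboundedUnder_le_of_le Filter.atTop (x := 0) fun n => by positivity)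
    hlim.isBoundedUnder_le

theorem entropy_le_of_forall_hasGrowth {F X : Type*} [Field F] [Finite X]
    (I : Ideal (FreeAlgebra F X)) [I.IsTwoSided] {t : ℝ} (ht : 0 < t)
    (h : ∀ μ : YoungDiagram, μ.card = hilbertFn I 2 → μ.HasGrowth t) : entropy I ≤ t := by
  have := Fintype.ofFinite X
  let _ : LinearOrder X := LinearOrder.lift' (Fintype.equivFin X) (Fintype.equivFin X).injective
  obtain ⟨μ, hμ, hle⟩ := exists_youngDiagram_walkCount (normalNbr I)
  obtain ⟨K, hK⟩ := h μ (hμ.trans (sum_card_normalNbr I))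
  refine limsup_rpow_le_of_le_geometric (K := Fintype.card X * K) ht fun n => ?_
  calc (hilbertFn I (n + 2) : ℝ)
      ≤ ∑ i ∈ range (Fintype.card X), (μ.walkCount (n + 1) i : ℝ) := by
        exact_mod_cast (hilbertFn_succ_le I (n + 1)).trans (hle (n + 1))
    _ ≤ ∑ i ∈ range (Fintype.card X), K * t ^ n := sum_le_sum fun i _ => hK n i
    _ = Fintype.card X * K * t ^ n := by simp [mul_assoc]

end EntropyBounds

open EntropyBounds in
theorem theorem1 :
    (∀ (F : Type u) (X : Type v) [Field F] [Finite X]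
      (I : Ideal (FreeAlgebra F X)) [I.IsTwoSided], I.IsHomogeneous (degreePart F X) →
      ∀ m l : ℕ, 1 ≤ l → l ≤ 2 * m → hilbertFn I 2 = m ^ 2 + l →
        entropy I ≤ ((m : ℝ) + √((m : ℝ) ^ 2 + 2 * l)) / 2 ∧
        ((m : ℝ) + √((m : ℝ) ^ 2 + 2 * l)) / 2 < √(hilbertFn I 2 : ℝ) ∧
        (l = 1 → entropy I ≤ m) ∧
        (l + 3 = 2 * m → entropy I ≤ ((m : ℝ) - 1 + √((m : ℝ) ^ 2 + 6 * m - 7)) / 2)) ∧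
    (∀ l : ℕ, ∃ M : ℕ, ∀ m : ℕ, M ≤ m →
      ∃ ρ : ℝ, IsLargestPositiveRoot m (l / 2) ((l + 1) / 2) ρ ∧
        ∀ (F : Type u) (X : Type v) [Field F] [Finite X]
          (I : Ideal (FreeAlgebra F X)) [I.IsTwoSided], I.IsHomogeneous (degreePart F X) →
          hilbertFn I 2 = m ^ 2 + l → entropy I ≤ ρ) := by
  refine ⟨fun F X _ _ I _ _ m l hl hlm hk => ⟨?_, ?_, ?_, ?_⟩, fun l => ?_⟩
  · have hm : (0 : ℝ) < m := by exact_mod_cast (show 0 < m by omega)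
    exact entropy_le_of_forall_hasGrowth I (by positivity) fun μ hμ =>
      μ.hasGrowth_of_card_eq_sq_add hl hlm (hμ.trans hk)
  · rw [hk]
    push_cast
    exact half_add_sqrt_lt_sqrt hl
  · rintro rfl
    have hm : 1 ≤ m := by omega
    exact entropy_le_of_forall_hasGrowth I (by exact_mod_cast hm) fun μ hμ =>
      μ.hasGrowth_of_card_eq_sq_add_one hm (hμ.trans hk)
  · intro hlm'
    have hm : (2 : ℝ) ≤ m := by exact_mod_cast (show 2 ≤ m by omega)
    refine entropy_le_of_forall_hasGrowth I ?_ fun μ hμ =>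
      μ.hasGrowth_of_card_eq_sq_add_two_mul_sub_three hl hlm' (hμ.trans hk)
    have := Real.sqrt_nonneg ((m : ℝ) ^ 2 + 6 * m - 7)
    linarith
  · refine ⟨2 * l ^ 2 + 2 * l + 1, fun m hm => ?_⟩
    have hm1 : 1 ≤ m := by omega
    have hp : l / 2 < m ^ 2 := (show l / 2 < m by omega).trans_le (Nat.le_self_pow two_ne_zero m)
    obtain ⟨ρ, hρ, hmρ, hroot⟩ := exists_isLargestPositiveRoot ((l + 1) / 2) hm1 hp
    exact ⟨ρ, hρ, fun F X _ _ I _ _ hk => entropy_le_of_forall_hasGrowth I hρ.1.1 fun μ hμ =>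
      μ.hasGrowth_of_root hm (hμ.trans hk) hmρ hroot⟩
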